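/- For a vector or polynomial $x$ with complex entries or coefficients, let $\|x\|$ be the sum of their absolute values. Let $p$ be a complex polynomial of degree $\nu$ with $p(0)\neq 0$, let $0<r<1<R<\infty$, and assume that $p$ has no zeros in the closed annulus $K=\{z\in\mathbb C: r\le |z|\le R\}$. Let $\varkappa$ be the number of zeros of $p$ in $|z|<1$, counted with multiplicity, and assume $0<\varkappa<\nu$. Let $p=p_1p_2$, where $p_1$ is the monic polynomial of degree $\varkappa$ whose zeros are those of $p$ in $|z|<1$, and $p_2$ is the polynomial of degree $\nu-\varkappa$ whose zeros are those of $p$ in $|z|>1$. Put $m_K=\min_{z\in K}|p(z)|$, $\rho=\max\{r,1/R\}$, $n_0=\max\{\varkappa,\nu-\varkappa\}$, let $\delta_0$ be any real number with $\|p_1\|\,\|p_2\|\le\delta_0\|p\|$, and let $0<q<1$. Let $n\ge n_0+1$, let $\ell$ be an even integer with $\ell\ge 2(n+\varkappa)$, and assume $$\frac{\rho^{\ell/2}}{1-\rho^{\ell}}<\frac{q\,m_K}{(4n+2)\,\delta_0\,\|p\|}.$$ For $k\in\mathbb Z$ put $\widetilde c_k=\frac1\ell\sum_{j=0}^{\ell-1}\frac{1}{p(\omega_j)\,\omega_j^{k}}$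 with $\omega_j=e^{2\pi i j/\ell}$ (approximations of the Laurent coefficients of $1/p$ on $K$). Then the matrices $(\widetilde c_{-\varkappa+i-j})_{i,j=0}^{n-1}$ and $(\widetilde c_{-\varkappa+i-j})_{i,j=0}^{n}$ are invertible, so the systems $$(\widetilde c_{-\varkappa+i-j})_{i,j=0}^{n-1}\,(\widetilde\alpha_1,\dots,\widetilde\alpha_n)^T=-(\widetilde c_{-n-\varkappa},\dots,\widetilde c_{-\varkappa-1})^T,\qquad (\widetilde c_{-\varkappa+i-j})_{i,j=0}^{n}\,(\widetilde\beta_0,\dots,\widetilde\beta_n)^T=(1,0,\dots,0)^T$$ have unique solutions, and the polynomials $$\widetilde p_1(z)=\widetilde\alpha_{n-\varkappa+1}+\dots+\widetilde\alpha_n z^{\varkappa-1}+z^{\varkappa},\qquad \widetilde p_2(z)=\widetilde\beta_0+\widetilde\beta_1z+\dots+\widetilde\beta_{\nu-\varkappa}z^{\nu-\varkappa}$$ satisfy $$\|p_1-\widetilde p_1\|<\frac{(4n-2)\,\delta_0\|p\|}{(1-q)m_K}\left[\frac{\delta_0(1+\rho)\|p\|}{(1-q)(1-\rho)m_K}+1\right]\frac{\rho^{\ell/2}}{1-\rho^{\ell}},\qquad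 \|p_2-\widetilde p_2\|<\frac{(4n+2)\,\delta_0^2\|p\|^2}{(1-q)m_K}\,\frac{\rho^{\ell/2}}{1-\rho^{\ell}}.$$ The same two bounds hold without discarding coefficients, that is, for $\|z^{n-\varkappa+1}p_1-\widetilde Q_1\|$ and $\|p_2-\widetilde Q_2\|$ respectively, where $\widetilde Q_1(z)=\widetilde\alpha_1z+\dots+\widetilde\alpha_nz^n+z^{n+1}$ and $\widetilde Q_2(z)=\widetilde\beta_0+\dots+\widetilde\beta_nz^n$. -/

import Mathlib

open Polynomial

noncomputable section

namespace WienerHopf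

/-- The `1`-norm of a polynomial: the sum of the absolute values of its coefficients. -/
def polyNorm (p : ℂ[X]) : ℝ := p.sum fun _ a => ‖a‖

/-- The number of zeros of `p` in the open unit disc, counted with multiplicity
(for a polynomial without zeros on the unit circle this is its index along the circle). -/
def index (p : ℂ[X]) : ℕ := (p.roots.filter fun z => ‖z‖ < 1).card

/-- The monic factor of `p` carrying the zeros in the open unit disc, with multiplicity. -/
def innerFactor (p : ℂ[X]) : ℂ[X] :=
  ((p.roots.filter fun z => ‖z‖ < 1).map fun ξ => X - C ξ).prod

/-- The factor of `p` carrying the zeros outside the closed unit disc, with multiplicity, and the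
leading coefficient of `p` (which is `1` for monic `p`). -/
def outerFactor (p : ℂ[X]) : ℂ[X] :=
  C p.leadingCoeff * ((p.roots.filter fun z => 1 < ‖z‖).map fun ξ => X - C ξ).prod

/-- The closed annulus `r ≤ |z| ≤ R`. -/
def annulus (r R : ℝ) : Set ℂ := {z | r ≤ ‖z‖ ∧ ‖z‖ ≤ R}

/-- The minimum of `|p|` on the annulus `r ≤ |z| ≤ R` (a minimum, by compactness, as soon as
`0 ≤ r ≤ R`). -/
def minModulus (p : ℂ[X]) (r R : ℝ) : ℝ := sInf ((fun z => ‖p.eval z‖) '' annulus r R)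

/-- The `j`-th of the `l`-th roots of unity, `exp (2πij/l)`. -/
def rootOfUnity (l j : ℕ) : ℂ := Complex.exp (2 * Real.pi * Complex.I / l * j)

/-- The approximation of the `k`-th Laurent coefficient of `1 / p` on the unit circle obtained
from the `l`-th roots of unity. -/
def approxCoeff (p : ℂ[X]) (l : ℕ) (k : ℤ) : ℂ :=
  (1 / (l : ℂ)) * ∑ j ∈ Finset.range l, 1 / (p.eval (rootOfUnity l j) * rootOfUnity l j ^ k)

/-- The square `m × m` Toeplitz matrix whose first row is `c k, c (k - 1), …` and whose first
column is `c k, c (k + 1), …`. -/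
def toeplitz (c : ℤ → ℂ) (k : ℤ) (m : ℕ) : Matrix (Fin m) (Fin m) ℂ :=
  Matrix.of fun i j => c (k + ((i : ℕ) : ℤ) - ((j : ℕ) : ℤ))

/-- `α = (α₁, …, αₙ)` (stored with indices `0, …, n - 1`) solves the `n × n` system
`T α = -(c_{-n-κ}, …, c_{-κ-1})ᵀ`, where `T` has the entries `c_{-κ+i-j}`. -/
def SolvesFirst (c : ℤ → ℂ) (κ n : ℕ) (α : Fin n → ℂ) : Prop :=
  (toeplitz c (-(κ : ℤ)) n).mulVec α =
    fun i : Fin n => -c (-(n : ℤ) - (κ : ℤ) + ((i : ℕ) : ℤ))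

/-- `β = (β₀, …, βₙ)` solves the `(n + 1) × (n + 1)` system `T β = (1, 0, …, 0)ᵀ`, where `T` has
the entries `c_{-κ+i-j}`. -/
def SolvesSecond (c : ℤ → ℂ) (κ n : ℕ) (β : Fin (n + 1) → ℂ) : Prop :=
  (toeplitz c (-(κ : ℤ)) (n + 1)).mulVec β = Pi.single 0 1

/-- `α₁ z + ⋯ + αₙ zⁿ + zⁿ⁺¹`. -/
def firstPoly {n : ℕ} (α : Fin n → ℂ) : ℂ[X] :=
  ∑ i : Fin n, C (α i) * X ^ ((i : ℕ) + 1) + X ^ (n + 1)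

/-- `β₀ + β₁ z + ⋯ + βₙ zⁿ`. -/
def secondPoly {n : ℕ} (β : Fin (n + 1) → ℂ) : ℂ[X] :=
  ∑ i : Fin (n + 1), C (β i) * X ^ (i : ℕ)

/-- `α_{n-κ+1} + ⋯ + αₙ z^{κ-1} + z^κ`. -/
def computedInner {n : ℕ} (κ : ℕ) (α : Fin n → ℂ) : ℂ[X] :=
  (∑ i : Fin n, if n - κ ≤ (i : ℕ) then C (α i) * X ^ ((i : ℕ) - (n - κ)) else 0) + X ^ κ

/-- `β₀ + β₁ z + ⋯ + β_d z^d`. -/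
def computedOuter {n : ℕ} (d : ℕ) (β : Fin (n + 1) → ℂ) : ℂ[X] :=
  ∑ i : Fin (n + 1), if (i : ℕ) ≤ d then C (β i) * X ^ (i : ℕ) else 0

end WienerHopf

end

open WienerHopf

/-!
Write `g₊ = p₂` and `g₋ = z ^ (-κ) p₁`. Since `p₁` is monic with all zeros in `|z| < 1` and `p₂` has
all zeros in `|z| > 1`, the symbol `z ^ κ / p = 1 / (g₋ g₊)` is in Wiener-Hopf form: `1 / g₋` has
only powers `z ^ k` with `k ≤ 0` and constant term `1`, and `1 / g₊` only powers with `k ≥ 0`. The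
matrices `(c_{-κ+i-j})` are the finite Toeplitz sections of this symbol, and as soon as their order
exceeds both `κ` and `ν - κ` the inverse is explicit: its column `j` holds the coefficients of
`g₊ P_{≥ 0} (g₋ z ^ j) - g₋ P_{> N} (g₊ z ^ j)`, where `N + 1` is the order. Every product of a
coefficient of `p₁` and one of `p₂` enters a column with weight `0`, `1` or `-1`, so in the
column-sum norm the inverse is bounded by `‖p₁‖ ‖p₂‖ ≤ δ₀ ‖p‖`
(`toeplitz_mul_toeplitzInverse`, `sum_norm_toeplitzInverse_le`). The unperturbed systems are solved
by the coefficients of `z ^ (n - κ + 1) p₁` and of `p₂`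
(`IsFactoredInverse.solvesFirst`, `IsFactoredInverse.solvesSecond`).

By Cauchy's estimate on the two boundary circles of the annulus, `|c_k| ≤ ρ ^ |k| / m_K`
(`norm_circleCoeff_le`). The computed `c̃_k` is the sum of all `c_{k+sℓ}`, so that
`|c̃_k - c_k| ≤ (2 / m_K) ρ ^ (ℓ / 2) / (1 - ρ ^ ℓ)` for `|k| ≤ ℓ / 2` (`norm_approxCoeff_sub_le`),
which covers every entry of the two systems because `ℓ ≥ 2 (n + κ)`. By the smallness hypothesis,
`δ₀ ‖p‖` times the norm of the perturbation of the matrix is at most `q`, hence the perturbed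
matrix is bounded below by `(1 - q) / (δ₀ ‖p‖)` (`sum_norm_le_of_perturb`). Applied to the
difference of the exact and the computed solutions, this gives both error bounds; the factor in
brackets in the first one bounds `1 + ∑ |αᵢ|`, estimated from the exact system by
`δ₀ ‖p‖ ∑_{k < 0} |c_k| + 1`.
-/

namespace WienerHopf

/-! ### Column-sum norms and perturbation of matrices -/

lemma sum_norm_mulVec_le {m : ℕ} (A : Matrix (Fin m) (Fin m) ℂ) {M : ℝ}
    (hA : ∀ j, ∑ i, ‖A i j‖ ≤ M) (x : Fin m → ℂ) :
    ∑ i, ‖A.mulVec x i‖ ≤ M * ∑ j, ‖x j‖ := by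
  calc ∑ i, ‖A.mulVec x i‖ ≤ ∑ i, ∑ j, ‖A i j‖ * ‖x j‖ := by
        refine Finset.sum_le_sum fun i _ => ?_
        simp only [Matrix.mulVec, dotProduct]
        exact (norm_sum_le _ _).trans (Finset.sum_le_sum fun j _ => (norm_mul _ _).le)
    _ = ∑ j, (∑ i, ‖A i j‖) * ‖x j‖ := by
        rw [Finset.sum_comm]
        exact Finset.sum_congr rfl fun j _ => (Finset.sum_mul _ _ _).symm
    _ ≤ ∑ j, M * ‖x j‖ :=
        Finset.sum_le_sum fun j _ => mul_le_mul_of_nonneg_right (hA j) (norm_nonneg _)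
    _ = M * ∑ j, ‖x j‖ := (Finset.mul_sum _ _ _).symm

/-- A quantitative Neumann-type estimate in the column-sum norm: if `S` is a right inverse of `A`
with `‖S‖ ≤ M`, and `‖B - A‖ ≤ η` with `M η ≤ q`, then `B` is bounded below by `(1 - q) / M`. -/
lemma sum_norm_le_of_perturb {m : ℕ} (A B S : Matrix (Fin m) (Fin m) ℂ) {M η q : ℝ}
    (hM : 0 ≤ M) (hAS : A * S = 1) (hS : ∀ j, ∑ i, ‖S i j‖ ≤ M)
    (hAB : ∀ j, ∑ i, ‖(B - A) i j‖ ≤ η) (hq : M * η ≤ q) (x : Fin m → ℂ) :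
    (1 - q) * ∑ i, ‖x i‖ ≤ M * ∑ i, ‖B.mulVec x i‖ := by
  have hSA : S * A = 1 := mul_eq_one_comm.mp hAS
  have h1 : ∑ i, ‖x i‖ ≤ M * ∑ i, ‖A.mulVec x i‖ := by
    have := sum_norm_mulVec_le S hS (A.mulVec x)
    rwa [Matrix.mulVec_mulVec, hSA, Matrix.one_mulVec] at this
  have h2 : ∑ i, ‖A.mulVec x i‖ ≤ ∑ i, ‖B.mulVec x i‖ + η * ∑ i, ‖x i‖ := by
    refine le_trans ?_ (add_le_add_right (sum_norm_mulVec_le (B - A) hAB x) _)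
    rw [← Finset.sum_add_distrib]
    refine Finset.sum_le_sum fun i _ => ?_
    have : A.mulVec x i = B.mulVec x i - (B - A).mulVec x i := by
      rw [Matrix.sub_mulVec]; simp
    rw [this]
    exact norm_sub_le _ _
  have h0 : 0 ≤ ∑ i, ‖x i‖ := Finset.sum_nonneg fun i _ => norm_nonneg _
  have h3 := mul_le_mul_of_nonneg_left h2 hM
  have h4 := mul_le_mul_of_nonneg_right hq h0
  nlinarith

lemma isUnit_det_of_bounded_below {m : ℕ} (B : Matrix (Fin m) (Fin m) ℂ) {M t : ℝ} (ht : 0 < t)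
    (h : ∀ x : Fin m → ℂ, t * ∑ i, ‖x i‖ ≤ M * ∑ i, ‖B.mulVec x i‖) : IsUnit B.det := by
  rw [← Matrix.isUnit_iff_isUnit_det, ← Matrix.mulVec_injective_iff_isUnit]
  intro x y hxy
  have hz : B.mulVec (x - y) = 0 := by
    rw [Matrix.mulVec_sub, sub_eq_zero]; exact hxy
  have h1 := h (x - y)
  simp only [hz, Pi.zero_apply, norm_zero, Finset.sum_const_zero, mul_zero] at h1
  have h0 : 0 ≤ ∑ i, ‖(x - y) i‖ := Finset.sum_nonneg fun i _ => norm_nonneg _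
  have h2 : ∑ i, ‖(x - y) i‖ = 0 := by nlinarith
  ext i
  have := (Finset.sum_eq_zero_iff_of_nonneg (fun i _ => norm_nonneg _)).1 h2 i (Finset.mem_univ i)
  rw [norm_eq_zero] at this
  exact sub_eq_zero.1 this

/-! ### The explicit inverse of the Toeplitz sections -/

/-- The weight `[κ ≤ j + b] - [N < a + j]` of the product `(p₂)ₐ (p₁)_b` in column `j` of the
inverse Toeplitz matrix. -/
def inverseWeight (κ N j a b : ℕ) : ℂ :=
  (if κ ≤ j + b then 1 else 0) - (if N < a + j then 1 else 0)

/-- The inverse of the finite Toeplitz section of `z ^ κ / (p₁ p₂)`. With `g₊ = p₂` and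
`g₋ = z ^ (-κ) p₁`, its column `j` holds the coefficients of
`g₊ P_{≥ 0} (g₋ z ^ j) - g₋ P_{> N} (g₊ z ^ j)`, which is a polynomial of degree at most `N`. -/
def toeplitzInverse (p₁ p₂ : ℂ[X]) (κ d N : ℕ) : Matrix (Fin (N + 1)) (Fin (N + 1)) ℂ :=
  Matrix.of fun m j => ∑ a ∈ Finset.range (d + 1), ∑ b ∈ Finset.range (κ + 1),
    if (m : ℕ) + κ = j + a + b then
      p₂.coeff a * p₁.coeff b * inverseWeight κ N j a b else 0

lemma norm_inverseWeight_le (κ N j a b : ℕ) : ‖inverseWeight κ N j a b‖ ≤ 1 := by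
  unfold inverseWeight
  split_ifs <;> simp

lemma sum_norm_toeplitzInverse_le (p₁ p₂ : ℂ[X]) (κ d N : ℕ) (j : Fin (N + 1)) :
    ∑ m, ‖toeplitzInverse p₁ p₂ κ d N m j‖ ≤
      (∑ b ∈ Finset.range (κ + 1), ‖p₁.coeff b‖) * ∑ a ∈ Finset.range (d + 1), ‖p₂.coeff a‖ := by
  calc ∑ m, ‖toeplitzInverse p₁ p₂ κ d N m j‖
      ≤ ∑ m : Fin (N + 1), ∑ a ∈ Finset.range (d + 1), ∑ b ∈ Finset.range (κ + 1),
          if (m : ℕ) + κ = j + a + b then ‖p₂.coeff a‖ * ‖p₁.coeff b‖ else 0 := by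
        refine Finset.sum_le_sum fun m _ => ?_
        simp only [toeplitzInverse, Matrix.of_apply]
        refine (norm_sum_le _ _).trans (Finset.sum_le_sum fun a _ => ?_)
        refine (norm_sum_le _ _).trans (Finset.sum_le_sum fun b _ => ?_)
        split_ifs
        · rw [norm_mul, norm_mul]
          exact mul_le_of_le_one_right (by positivity) (norm_inverseWeight_le _ _ _ _ _)
        · simp
    _ = ∑ a ∈ Finset.range (d + 1), ∑ b ∈ Finset.range (κ + 1), ∑ m : Fin (N + 1),
          if (m : ℕ) + κ = j + a + b then ‖p₂.coeff a‖ * ‖p₁.coeff b‖ else 0 := by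
        rw [Finset.sum_comm]
        exact Finset.sum_congr rfl fun a _ => Finset.sum_comm
    _ ≤ ∑ a ∈ Finset.range (d + 1), ∑ b ∈ Finset.range (κ + 1), ‖p₂.coeff a‖ * ‖p₁.coeff b‖ := by
        refine Finset.sum_le_sum fun a _ => Finset.sum_le_sum fun b _ => ?_
        by_cases h : ∃ m : Fin (N + 1), (m : ℕ) + κ = j + a + b
        · obtain ⟨m, hm⟩ := h
          rw [Finset.sum_eq_single m]
          · rw [if_pos hm]
          · intro m' _ hne
            rw [if_neg]
            intro h'
            exact hne (Fin.ext (by omega))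
          · simp
        · push Not at h
          rw [Finset.sum_eq_zero fun m _ => if_neg (h m)]
          positivity
    _ = _ := by
        rw [mul_comm, Finset.sum_mul_sum]

/-- The hypotheses say that `c`, `u`, `v` behave as the Laurent coefficients on the unit circle of
`1 / (p₁ p₂)`, `1 / p₁` and `1 / p₂`. -/
lemma toeplitz_mul_toeplitzInverse (p₁ p₂ : ℂ[X]) {κ d N : ℕ} (hκ : κ ≤ N) (hd : d ≤ N)
    (c u v : ℤ → ℂ)
    (hcu : ∀ k, ∑ a ∈ Finset.range (d + 1), p₂.coeff a * c (k - a) = u k)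
    (hcv : ∀ k, ∑ b ∈ Finset.range (κ + 1), p₁.coeff b * c (k - b) = v k)
    (hu : ∀ k, -(κ : ℤ) < k → u k = 0) (hv : ∀ k, k < 0 → v k = 0)
    (hu1 : ∀ k, ∑ b ∈ Finset.range (κ + 1), p₁.coeff b * u (k - b) = if k = 0 then 1 else 0) :
    toeplitz c (-(κ : ℤ)) (N + 1) * toeplitzInverse p₁ p₂ κ d N = 1 := by
  ext i j
  have hi := i.2
  have hj := j.2
  have key : ∀ a ∈ Finset.range (d + 1), ∀ b ∈ Finset.range (κ + 1),
      (∑ m : Fin (N + 1), c (-(κ : ℤ) + (i : ℕ) - (m : ℕ)) *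
        (if (m : ℕ) + κ = j + a + b then
          p₂.coeff a * p₁.coeff b * inverseWeight κ N j a b else 0)) =
      p₂.coeff a * p₁.coeff b * inverseWeight κ N j a b * c ((i : ℕ) - (j : ℕ) - b - a) := by
    intro a ha b hb
    rw [Finset.mem_range] at ha hb
    by_cases h : κ ≤ j + a + b ∧ j + a + b ≤ N + κ
    · rw [Finset.sum_eq_single (⟨j + a + b - κ, by omega⟩ : Fin (N + 1))]
      · rw [if_pos (by simp only; omega), mul_comm]
        congr 2
        push_cast [h.1]
        ring
      · intro m _ hne
        rw [if_neg, mul_zero]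
        intro h'
        exact hne (Fin.ext (by simp only; omega))
      · simp
    -- outside this range of degrees the two truncations cancel or are both void
    · have hw : inverseWeight κ N j a b = 0 := by
        unfold inverseWeight
        split_ifs <;> first | (exfalso; omega) | simp
      simp [hw]
  calc (toeplitz c (-(κ : ℤ)) (N + 1) * toeplitzInverse p₁ p₂ κ d N) i j
      = ∑ m : Fin (N + 1), ∑ a ∈ Finset.range (d + 1), ∑ b ∈ Finset.range (κ + 1),
          c (-(κ : ℤ) + (i : ℕ) - (m : ℕ)) * (if (m : ℕ) + κ = j + a + b then
          p₂.coeff a * p₁.coeff b * inverseWeight κ N j a b else 0) := by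
        rw [Matrix.mul_apply]
        simp only [toeplitz, toeplitzInverse, Matrix.of_apply, Finset.mul_sum]
    _ = ∑ a ∈ Finset.range (d + 1), ∑ b ∈ Finset.range (κ + 1),
          p₂.coeff a * p₁.coeff b * inverseWeight κ N j a b * c ((i : ℕ) - (j : ℕ) - b - a) := by
        rw [Finset.sum_comm]
        refine Finset.sum_congr rfl fun a ha => ?_
        rw [Finset.sum_comm]
        exact Finset.sum_congr rfl fun b hb => key a ha b hb
    _ = ∑ b ∈ Finset.range (κ + 1), p₁.coeff b * (if κ ≤ j + b then 1 else 0) *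
            u ((i : ℕ) - (j : ℕ) - b) -
          ∑ a ∈ Finset.range (d + 1), p₂.coeff a * (if N < a + j then 1 else 0) *
            v ((i : ℕ) - (j : ℕ) - a) := by
        simp only [← hcu, ← hcv, Finset.mul_sum]
        rw [Finset.sum_comm (s := Finset.range (κ + 1)), ← Finset.sum_sub_distrib]
        refine Finset.sum_congr rfl fun a _ => ?_
        rw [← Finset.sum_sub_distrib]
        refine Finset.sum_congr rfl fun b _ => ?_
        rw [show ((i : ℕ) : ℤ) - (j : ℕ) - a - b = (i : ℕ) - (j : ℕ) - b - a by ring]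
        unfold inverseWeight
        ring
    _ = ∑ b ∈ Finset.range (κ + 1), p₁.coeff b * u ((i : ℕ) - (j : ℕ) - b) - 0 := by
        congr 1
        -- the truncations only drop vanishing coefficients of `1 / p₁` and keep those of `1 / p₂`
        -- with negative index
        · refine Finset.sum_congr rfl fun b _ => ?_
          split_ifs with h
          · ring
          · rw [hu _ (by omega)]; ring
        · refine Finset.sum_eq_zero fun a _ => ?_
          split_ifs with h
          · rw [hv _ (by omega)]; ring
          · ring
    _ = (1 : Matrix (Fin (N + 1)) (Fin (N + 1)) ℂ) i j := by
        rw [hu1, sub_zero, Matrix.one_apply]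
        congr 1
        rw [Fin.ext_iff, eq_iff_iff]
        omega

/-! ### Laurent coefficients on the unit circle -/

section

open Metric

/-- The `k`-th Laurent coefficient of `g` on the unit circle. -/
noncomputable def circleCoeff (g : ℂ → ℂ) (k : ℤ) : ℂ :=
  (2 * Real.pi * Complex.I)⁻¹ * ∮ z in C(0, 1), g z * z ^ (-k - 1)

lemma circleCoeff_congr {g h : ℂ → ℂ} (hgh : Set.EqOn g h (sphere 0 1)) (k : ℤ) :
    circleCoeff g k = circleCoeff h k := by
  unfold circleCoeff
  congr 1
  refine circleIntegral.integral_congr zero_le_one fun z hz => ?_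
  simp only [hgh hz]

lemma ne_zero_of_mem_sphere {z : ℂ} {ρ : ℝ} (hρ : 0 < ρ) (hz : z ∈ sphere (0 : ℂ) ρ) : z ≠ 0 := by
  rintro rfl
  simp at hz
  exact hρ.ne hz

/-- Multiplication by a polynomial acts on Laurent coefficients by convolution. -/
lemma sum_coeff_mul_circleCoeff {g : ℂ → ℂ} (hg : ContinuousOn g (sphere 0 1)) (f : ℂ[X]) {N : ℕ}
    (hN : f.natDegree < N) (k : ℤ) :
    ∑ a ∈ Finset.range N, f.coeff a * circleCoeff g (k - a) =
      circleCoeff (fun z => f.eval z * g z) k := by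
  unfold circleCoeff
  have hint : ∀ a ∈ Finset.range N, CircleIntegrable
      (fun z => f.coeff a * (g z * z ^ (-(k - a) - 1))) 0 1 := by
    intro a _
    refine ContinuousOn.circleIntegrable zero_le_one ?_
    refine continuousOn_const.mul (hg.mul ?_)
    exact continuousOn_id.zpow₀ _ fun z hz => Or.inl (ne_zero_of_mem_sphere one_pos hz)
  have : ∀ z ∈ sphere (0 : ℂ) 1, f.eval z * g z * z ^ (-k - 1) =
      ∑ a ∈ Finset.range N, f.coeff a * (g z * z ^ (-(k - a) - 1)) := by
    intro z hz
    have hz0 := ne_zero_of_mem_sphere one_pos hz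
    rw [eval_eq_sum_range' hN, Finset.sum_mul, Finset.sum_mul]
    refine Finset.sum_congr rfl fun a _ => ?_
    rw [show -(k - (a : ℤ)) - 1 = a + (-k - 1) by ring, zpow_add₀ hz0, zpow_natCast]
    ring
  rw [circleIntegral.integral_congr zero_le_one this, circleIntegral.integral_fun_sum hint,
    Finset.mul_sum]
  refine Finset.sum_congr rfl fun a _ => ?_
  rw [circleIntegral.integral_const_mul]
  ring

lemma circleCoeff_one (k : ℤ) : circleCoeff (fun _ => 1) k = if k = 0 then 1 else 0 := by
  unfold circleCoeff
  simp only [one_mul]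
  split_ifs with h
  · subst h
    have := circleIntegral.integral_sub_center_inv 0 (one_ne_zero (α := ℝ))
    simp only [sub_zero] at this
    simp only [neg_zero, zero_sub, zpow_neg, zpow_one]
    rw [this, inv_mul_cancel₀ Complex.two_pi_I_ne_zero]
  · have := circleIntegral.integral_sub_zpow_of_ne (n := -k - 1) (by omega) 0 0 1
    simp only [sub_zero] at this
    rw [this, mul_zero]

/-- Deformation of the contour of a Laurent coefficient to another radius. -/
lemma circleIntegral_mul_zpow_eq_of_annulus {g : ℂ → ℂ} {a b : ℝ} (ha : 0 < a) (hab : a ≤ b)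
    (hg : ∀ z : ℂ, a ≤ ‖z‖ → ‖z‖ ≤ b → DifferentiableAt ℂ g z) (k : ℤ) :
    (∮ z in C(0, b), g z * z ^ (-k - 1)) = ∮ z in C(0, a), g z * z ^ (-k - 1) := by
  have hd : ∀ z : ℂ, a ≤ ‖z‖ → ‖z‖ ≤ b → DifferentiableAt ℂ (fun z => g z * z ^ (-k - 1)) z := by
    intro z h1 h2
    refine (hg z h1 h2).mul (differentiableAt_zpow.2 (Or.inl ?_))
    rintro rfl
    rw [norm_zero] at h1
    exact absurd ha (not_lt.2 h1)
  refine Complex.circleIntegral_eq_of_differentiable_on_annulus_off_countable ha hab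
    Set.countable_empty ?_ ?_
  · intro z hz
    simp only [Set.mem_sdiff, mem_closedBall, mem_ball, dist_zero_right, not_lt] at hz
    exact (hd z hz.2 hz.1).continuousAt.continuousWithinAt
  · intro z hz
    simp only [Set.mem_sdiff, mem_closedBall, mem_ball, dist_zero_right, not_le,
      Set.mem_empty_iff_false, not_false_eq_true, and_true] at hz
    exact hd z hz.2.le hz.1.le

lemma norm_inv_mul_circleIntegral_le {g : ℂ → ℂ} {s C : ℝ} (hs : 0 < s)
    (hC : ∀ z : ℂ, ‖z‖ = s → ‖g z‖ ≤ C) (k : ℤ) :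
    ‖(2 * Real.pi * Complex.I : ℂ)⁻¹ * ∮ z in C(0, s), g z * z ^ (-k - 1)‖ ≤ C * s ^ (-k) := by
  have h := circleIntegral.norm_two_pi_i_inv_smul_integral_le_of_norm_le_const (c := 0) hs.le
    (f := fun z => g z * z ^ (-k - 1)) (C := C * s ^ (-k - 1)) (by
      intro z hz
      simp only [mem_sphere, dist_zero_right] at hz
      rw [norm_mul, norm_zpow, hz]
      exact mul_le_mul_of_nonneg_right (hC z hz) (by positivity))
  rw [smul_eq_mul] at h
  refine h.trans (le_of_eq ?_)
  rw [show -k = (-k - 1) + 1 by ring, zpow_add_one₀ hs.ne']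
  ring_nf

/-- Cauchy's estimate on an annulus around the unit circle: moving the contour to the inner or to
the outer boundary, according to the sign of `k`, gains a factor `ρ ^ |k|`. -/
lemma norm_circleCoeff_le {g : ℂ → ℂ} {r R ρ C : ℝ} (hr0 : 0 < r) (hr1 : r ≤ 1) (hR : 1 ≤ R)
    (hrρ : r ≤ ρ) (hRρ : R⁻¹ ≤ ρ) (hC0 : 0 ≤ C)
    (hg : ∀ z : ℂ, r ≤ ‖z‖ → ‖z‖ ≤ R → DifferentiableAt ℂ g z)
    (hC : ∀ z : ℂ, r ≤ ‖z‖ → ‖z‖ ≤ R → ‖g z‖ ≤ C) (k : ℤ) :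
    ‖circleCoeff g k‖ ≤ C * ρ ^ k.natAbs := by
  unfold circleCoeff
  obtain ⟨n, rfl | rfl⟩ := k.eq_nat_or_neg
  · rw [← circleIntegral_mul_zpow_eq_of_annulus one_pos hR fun z h1 h2 => hg z (hr1.trans h1) h2]
    refine (norm_inv_mul_circleIntegral_le (one_pos.trans_le hR)
      (fun z hz => hC z (by linarith) hz.le) _).trans ?_
    rw [Int.natAbs_natCast, zpow_neg, zpow_natCast, ← inv_pow]
    gcongr
  · rw [circleIntegral_mul_zpow_eq_of_annulus hr0 hr1 fun z h1 h2 => hg z h1 (h2.trans hR)]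
    refine (norm_inv_mul_circleIntegral_le hr0
      (fun z hz => hC z hz.ge (by linarith)) _).trans ?_
    rw [Int.natAbs_neg, Int.natAbs_natCast, neg_neg, zpow_natCast]
    gcongr

lemma circleCoeff_eq_zero_of_neg {g : ℂ → ℂ}
    (hg : ∀ z : ℂ, ‖z‖ ≤ 1 → DifferentiableAt ℂ g z) {k : ℤ} (hk : k < 0) :
    circleCoeff g k = 0 := by
  unfold circleCoeff
  obtain ⟨n, hn⟩ : ∃ n : ℕ, -k - 1 = n := ⟨(-k - 1).toNat, by omega⟩
  simp only [hn, zpow_natCast]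
  have hd : ∀ z : ℂ, ‖z‖ ≤ 1 → DifferentiableAt ℂ (fun z => g z * z ^ n) z := fun z hz =>
    (hg z hz).mul (differentiableAt_id.pow n)
  rw [Complex.circleIntegral_eq_zero_of_differentiable_on_off_countable zero_le_one
    Set.countable_empty, mul_zero]
  · intro z hz
    exact (hd z (by simpa using hz)).continuousAt.continuousWithinAt
  · intro z hz
    exact hd z (mem_ball_zero_iff.1 hz.1).le

/-- If `g` is holomorphic outside the open unit disc and `O(z ^ (-κ))` at infinity, its Laurent
coefficients with index above `-κ` vanish. -/
lemma circleCoeff_eq_zero_of_decay {g : ℂ → ℂ} {κ : ℕ} {A : ℝ}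
    (hg : ∀ z : ℂ, 1 ≤ ‖z‖ → DifferentiableAt ℂ g z)
    (hA : ∀ z : ℂ, 2 ≤ ‖z‖ → ‖g z‖ * ‖z‖ ^ κ ≤ A) {k : ℤ} (hk : -(κ : ℤ) < k) :
    circleCoeff g k = 0 := by
  -- the contour is moved to a circle of radius `s → ∞`
  have hA0 : 0 ≤ A := le_trans (by positivity) (hA 2 (by simp))
  have hb : ∀ s : ℝ, 2 ≤ s → ‖circleCoeff g k‖ ≤ A * s⁻¹ := by
    intro s hs
    have hs0 : 0 < s := by linarith
    unfold circleCoeff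
    rw [← circleIntegral_mul_zpow_eq_of_annulus one_pos (by linarith : (1 : ℝ) ≤ s)
      fun z h1 _ => hg z h1]
    refine (norm_inv_mul_circleIntegral_le (C := A * s ^ (-(κ : ℤ))) hs0 (fun z hz => ?_) _).trans ?_
    · have := hA z (by linarith)
      rw [hz] at this
      rw [zpow_neg, zpow_natCast, ← div_eq_mul_inv, le_div_iff₀ (by positivity)]
      exact this
    · rw [mul_assoc, ← zpow_add₀ hs0.ne', ← zpow_neg_one]
      exact mul_le_mul_of_nonneg_left (zpow_le_zpow_right₀ (by linarith) (by omega)) hA0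
  have hlim : Filter.Tendsto (fun s : ℝ => A * s⁻¹) Filter.atTop (nhds 0) := by
    simpa using tendsto_inv_atTop_zero.const_mul A
  have h0 : ‖circleCoeff g k‖ ≤ 0 :=
    ge_of_tendsto hlim (Filter.eventually_atTop.2 ⟨2, hb⟩)
  exact norm_le_zero_iff.1 h0

end

/-! ### Aliasing -/

lemma summable_of_norm_le_pow_natAbs {c : ℤ → ℂ} {C ρ : ℝ} (hρ0 : 0 ≤ ρ) (hρ1 : ρ < 1)
    (hc : ∀ k, ‖c k‖ ≤ C * ρ ^ k.natAbs) : Summable fun k => ‖c k‖ := by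
  have hs : Summable fun n : ℕ => C * ρ ^ n := (summable_geometric_of_lt_one hρ0 hρ1).mul_left C
  refine Summable.of_nat_of_neg (Summable.of_nonneg_of_le (fun _ => norm_nonneg _) (fun n => ?_) hs)
    (Summable.of_nonneg_of_le (fun _ => norm_nonneg _) (fun n => ?_) hs)
  · simpa using hc n
  · simpa using hc (-n)

/-- A summable sequence whose convolution with the coefficients of `p` is the unit sequence sums
to `1 / p` on the unit circle: the product of `p` and its Laurent series is `1`. -/
lemma hasSum_mul_zpow_inv_eval {p : ℂ[X]} {c : ℤ → ℂ} (hs : Summable fun k => ‖c k‖)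
    (hc : ∀ k, ∑ a ∈ Finset.range (p.natDegree + 1), p.coeff a * c (k - a) =
      if k = 0 then 1 else 0) {z : ℂ} (hz : ‖z‖ = 1) :
    HasSum (fun k : ℤ => c k * z ^ k) (p.eval z)⁻¹ := by
  have hz0 : z ≠ 0 := by rintro rfl; simp at hz
  have hsum : Summable fun k : ℤ => c k * z ^ k := by
    refine Summable.of_norm ?_
    simpa [norm_mul, norm_zpow, hz] using hs
  have hF := hsum.hasSum
  set F := ∑' k : ℤ, c k * z ^ k
  have hshift : ∀ a ∈ Finset.range (p.natDegree + 1),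
      HasSum (fun k : ℤ => p.coeff a * c (k - a) * z ^ k) (p.coeff a * z ^ a * F) := by
    intro a _
    have h1 := ((Equiv.subRight (a : ℤ)).hasSum_iff.2 hF).mul_left (p.coeff a * z ^ a)
    refine h1.congr_fun ?_
    intro k
    simp only [Function.comp, Equiv.subRight_apply]
    rw [zpow_sub₀ hz0, zpow_natCast]
    field_simp
  have h2 := hasSum_sum hshift
  have h3 : HasSum (fun k : ℤ => if k = 0 then (1 : ℂ) else 0) (p.eval z * F) := by
    rw [eval_eq_sum_range, Finset.sum_mul]
    refine h2.congr_fun ?_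
    intro k
    rw [← Finset.sum_mul, hc]
    split_ifs with h
    · simp [h]
    · simp
  have h4 : p.eval z * F = 1 := h3.unique (hasSum_ite_eq 0 1)
  rwa [eq_inv_of_mul_eq_one_right h4] at hF

lemma rootOfUnity_eq_pow (l j : ℕ) :
    rootOfUnity l j = Complex.exp (2 * Real.pi * Complex.I / l) ^ j := by
  rw [rootOfUnity, ← Complex.exp_nat_mul, mul_comm]

lemma norm_rootOfUnity (l j : ℕ) : ‖rootOfUnity l j‖ = 1 := by
  rw [rootOfUnity, show (2 * Real.pi * Complex.I / l * j : ℂ) =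
    ((2 * Real.pi / l * j : ℝ) : ℂ) * Complex.I by push_cast; ring]
  exact Complex.norm_exp_ofReal_mul_I _

lemma sum_rootOfUnity_zpow {l : ℕ} (hl : l ≠ 0) (m : ℤ) :
    ∑ j ∈ Finset.range l, rootOfUnity l j ^ m = if (l : ℤ) ∣ m then (l : ℂ) else 0 := by
  have hζ := Complex.isPrimitiveRoot_exp l hl
  have h1 : ∀ j, rootOfUnity l j ^ m =
      (Complex.exp (2 * Real.pi * Complex.I / l) ^ m) ^ j := by
    intro j
    rw [rootOfUnity_eq_pow, ← zpow_natCast, ← zpow_natCast, zpow_comm]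
  simp only [h1]
  split_ifs with h
  · rw [(hζ.zpow_eq_one_iff_dvd m).2 h]
    simp
  · have hne : Complex.exp (2 * Real.pi * Complex.I / l) ^ m ≠ 1 := fun h' =>
      h ((hζ.zpow_eq_one_iff_dvd m).1 h')
    rw [geom_sum_eq hne, ← zpow_natCast, zpow_comm, zpow_natCast, hζ.pow_eq_one]
    simp

/-- Aliasing: the discrete Fourier coefficient collects the Laurent coefficients of `1 / p` whose
indices agree modulo `l`. -/
lemma hasSum_approxCoeff {p : ℂ[X]} {c : ℤ → ℂ} (hs : Summable fun k => ‖c k‖)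
    (hc : ∀ k, ∑ a ∈ Finset.range (p.natDegree + 1), p.coeff a * c (k - a) =
      if k = 0 then 1 else 0) {l : ℕ} (hl : l ≠ 0) (k : ℤ) :
    HasSum (fun s : ℤ => c (k + s * l)) (approxCoeff p l k) := by
  have hl' : (l : ℂ) ≠ 0 := Nat.cast_ne_zero.2 hl
  have h1 : HasSum (fun m : ℤ => if (l : ℤ) ∣ m - k then c m else 0) (approxCoeff p l k) := by
    have h2 := (hasSum_sum fun j (_ : j ∈ Finset.range l) =>
      (hasSum_mul_zpow_inv_eval hs hc (norm_rootOfUnity l j)).mul_right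
        (rootOfUnity l j ^ (-k))).mul_left (1 / (l : ℂ))
    have h3 : approxCoeff p l k = 1 / (l : ℂ) * ∑ j ∈ Finset.range l,
        (p.eval (rootOfUnity l j))⁻¹ * rootOfUnity l j ^ (-k) := by
      unfold approxCoeff
      congr 1
      refine Finset.sum_congr rfl fun j _ => ?_
      rw [one_div, mul_inv, zpow_neg]
    rw [h3]
    refine h2.congr_fun ?_
    intro m
    have h4 : ∀ j ∈ Finset.range l, c m * rootOfUnity l j ^ m * rootOfUnity l j ^ (-k) =
        c m * rootOfUnity l j ^ (m - k) := by
      intro j _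
      have : rootOfUnity l j ≠ 0 := Complex.exp_ne_zero _
      rw [mul_assoc, ← zpow_add₀ this, sub_eq_add_neg]
    rw [Finset.sum_congr rfl h4, ← Finset.mul_sum, sum_rootOfUnity_zpow hl]
    split_ifs
    · field_simp
    · simp
  have hinj : Function.Injective fun s : ℤ => k + s * l := by
    intro s t hst
    have : s * (l : ℤ) = t * l := by simpa using hst
    exact mul_right_cancel₀ (Nat.cast_ne_zero.2 hl) this
  refine ((hinj.hasSum_iff ?_).2 h1).congr_fun ?_
  · intro m hm
    rw [if_neg]
    rintro ⟨s, hs⟩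
    exact hm ⟨s, by simp only; linarith [mul_comm s (l : ℤ)]⟩
  · intro s
    simp only [Function.comp]
    rw [if_pos]
    exact ⟨s, by ring⟩

/-- The aliasing error for indices `|k| ≤ l / 2`. -/
lemma norm_approxCoeff_sub_le {p : ℂ[X]} {c : ℤ → ℂ} {C ρ : ℝ} (hρ0 : 0 < ρ) (hρ1 : ρ < 1)
    (hcC : ∀ k, ‖c k‖ ≤ C * ρ ^ k.natAbs)
    (hc : ∀ k, ∑ a ∈ Finset.range (p.natDegree + 1), p.coeff a * c (k - a) =
      if k = 0 then 1 else 0) {l : ℕ} (hl : l ≠ 0) {k : ℤ} (hk : 2 * k.natAbs ≤ l) :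
    ‖approxCoeff p l k - c k‖ ≤ 2 * C * (ρ ^ (l / 2) / (1 - ρ ^ l)) := by
  have hC0 : 0 ≤ C := by simpa using (norm_nonneg _).trans (hcC 0)
  have h1 := (hasSum_approxCoeff (summable_of_norm_le_pow_natAbs hρ0.le hρ1 hcC) hc hl k).sub
    (hasSum_ite_eq (0 : ℤ) (c k))
  -- `|k + s l| ≥ (|s| - 1) l + l / 2` for `s ≠ 0`, which gives a geometric majorant on each side
  let B : ℤ → ℝ := fun s => if s = 0 then 0 else C * ρ ^ (l / 2) * (ρ ^ l) ^ (s.natAbs - 1)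
  have hgeo : HasSum (fun t : ℕ => C * ρ ^ (l / 2) * (ρ ^ l) ^ t)
      (C * ρ ^ (l / 2) * (1 - ρ ^ l)⁻¹) :=
    (hasSum_geometric_of_lt_one (by positivity) (pow_lt_one₀ hρ0.le hρ1 hl)).mul_left _
  have hB : HasSum B (C * ρ ^ (l / 2) * (1 - ρ ^ l)⁻¹ + B 0 + C * ρ ^ (l / 2) * (1 - ρ ^ l)⁻¹) := by
    refine HasSum.of_add_one_of_neg_add_one (hgeo.congr_fun fun t => ?_)
      (hgeo.congr_fun fun t => ?_)
    · have h0 : ((t : ℤ) + 1) ≠ 0 := by omega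
      have h2 : ((t : ℤ) + 1).natAbs - 1 = t := by omega
      simp only [B, if_neg h0, h2]
    · have h0 : -((t : ℤ) + 1) ≠ 0 := by omega
      have h2 : (-((t : ℤ) + 1)).natAbs - 1 = t := by omega
      simp only [B, if_neg h0, h2]
  refine (h1.norm_le_of_bounded hB fun s => ?_).trans (le_of_eq ?_)
  · by_cases hs : s = 0
    · simp [B, hs]
    · simp only [B, if_neg hs, sub_zero]
      refine (hcC _).trans ?_
      rw [mul_assoc, ← pow_mul, ← pow_add]
      refine mul_le_mul_of_nonneg_left (pow_le_pow_of_le_one hρ0.le hρ1.le ?_) hC0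
      have h2 : s.natAbs * l ≤ (k + s * l).natAbs + k.natAbs := by
        calc s.natAbs * l = ((k + s * l) - k).natAbs := by
              rw [add_sub_cancel_left, Int.natAbs_mul, Int.natAbs_natCast]
          _ ≤ _ := Int.natAbs_sub_le _ _
      obtain ⟨t, ht⟩ : ∃ t, s.natAbs = t + 1 := ⟨s.natAbs - 1, by omega⟩
      rw [ht, Nat.add_sub_cancel]
      rw [ht, add_mul, mul_comm t l] at h2
      omega
  · simp only [B, if_true]
    ring

/-! ### The `1`-norm of polynomials -/

lemma polyNorm_eq_sum_range (f : ℂ[X]) {N : ℕ} (hN : f.natDegree < N) :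
    polyNorm f = ∑ i ∈ Finset.range N, ‖f.coeff i‖ :=
  f.sum_over_range' (fun _ => norm_zero) N hN

lemma polyNorm_nonneg (f : ℂ[X]) : 0 ≤ polyNorm f := by
  rw [polyNorm_eq_sum_range f (Nat.lt_succ_self _)]
  exact Finset.sum_nonneg fun _ _ => norm_nonneg _

lemma norm_coeff_le_polyNorm (f : ℂ[X]) (i : ℕ) : ‖f.coeff i‖ ≤ polyNorm f := by
  rw [polyNorm_eq_sum_range f (N := max i f.natDegree + 1) (by omega)]
  exact Finset.single_le_sum (f := fun i => ‖f.coeff i‖) (fun _ _ => norm_nonneg _)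
    (Finset.mem_range.2 (by omega))

lemma polyNorm_pos {f : ℂ[X]} (hf : f ≠ 0) : 0 < polyNorm f :=
  (norm_pos_iff.2 (leadingCoeff_ne_zero.2 hf)).trans_le (norm_coeff_le_polyNorm f f.natDegree)

lemma polyNorm_zero : polyNorm 0 = 0 := by simp [polyNorm]

lemma polyNorm_add_le (f g : ℂ[X]) : polyNorm (f + g) ≤ polyNorm f + polyNorm g := by
  have h := natDegree_add_le f g
  set N := max f.natDegree g.natDegree + 1
  rw [polyNorm_eq_sum_range (f + g) (N := N) (by omega),
    polyNorm_eq_sum_range f (N := N) (by omega), polyNorm_eq_sum_range g (N := N) (by omega),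
    ← Finset.sum_add_distrib]
  exact Finset.sum_le_sum fun i _ => by rw [coeff_add]; exact norm_add_le _ _

lemma polyNorm_sum_le {ι : Type*} (s : Finset ι) (f : ι → ℂ[X]) :
    polyNorm (∑ i ∈ s, f i) ≤ ∑ i ∈ s, polyNorm (f i) :=
  s.le_sum_of_subadditive polyNorm polyNorm_zero.le polyNorm_add_le f

lemma polyNorm_C_mul_X_pow (a : ℂ) (k : ℕ) : polyNorm (C a * X ^ k) = ‖a‖ := by
  rw [C_mul_X_pow_eq_monomial, polyNorm, sum_monomial_index _ _ norm_zero]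

lemma polyNorm_firstPoly_sub_le {n : ℕ} (α β : Fin n → ℂ) :
    polyNorm (firstPoly α - firstPoly β) ≤ ∑ i, ‖(α - β) i‖ := by
  have : firstPoly α - firstPoly β = ∑ i : Fin n, C ((α - β) i) * X ^ ((i : ℕ) + 1) := by
    simp only [firstPoly, add_sub_add_right_eq_sub, ← Finset.sum_sub_distrib, Pi.sub_apply, C_sub,
      sub_mul]
  rw [this]
  exact (polyNorm_sum_le _ _).trans
    (Finset.sum_le_sum fun i _ => (polyNorm_C_mul_X_pow _ _).le)

lemma polyNorm_secondPoly_sub_le {n : ℕ} (α β : Fin (n + 1) → ℂ) :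
    polyNorm (secondPoly α - secondPoly β) ≤ ∑ i, ‖(α - β) i‖ := by
  have : secondPoly α - secondPoly β = ∑ i : Fin (n + 1), C ((α - β) i) * X ^ (i : ℕ) := by
    simp only [secondPoly, ← Finset.sum_sub_distrib, Pi.sub_apply, C_sub, sub_mul]
  rw [this]
  exact (polyNorm_sum_le _ _).trans
    (Finset.sum_le_sum fun i _ => (polyNorm_C_mul_X_pow _ _).le)

lemma polyNorm_computedInner_sub_le {n : ℕ} (κ : ℕ) (α β : Fin n → ℂ) :
    polyNorm (computedInner κ α - computedInner κ β) ≤ ∑ i, ‖(α - β) i‖ := by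
  have : computedInner κ α - computedInner κ β = ∑ i : Fin n,
      if n - κ ≤ (i : ℕ) then C ((α - β) i) * X ^ ((i : ℕ) - (n - κ)) else 0 := by
    simp only [computedInner, add_sub_add_right_eq_sub, ← Finset.sum_sub_distrib]
    refine Finset.sum_congr rfl fun i _ => ?_
    split_ifs
    · simp only [Pi.sub_apply, C_sub, sub_mul]
    · simp
  rw [this]
  refine (polyNorm_sum_le _ _).trans (Finset.sum_le_sum fun i _ => ?_)
  split_ifs
  · exact (polyNorm_C_mul_X_pow _ _).le
  · rw [polyNorm_zero]; exact norm_nonneg _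

lemma polyNorm_computedOuter_sub_le {n : ℕ} (d : ℕ) (α β : Fin (n + 1) → ℂ) :
    polyNorm (computedOuter d α - computedOuter d β) ≤ ∑ i, ‖(α - β) i‖ := by
  have : computedOuter d α - computedOuter d β = ∑ i : Fin (n + 1),
      if (i : ℕ) ≤ d then C ((α - β) i) * X ^ (i : ℕ) else 0 := by
    simp only [computedOuter, ← Finset.sum_sub_distrib]
    refine Finset.sum_congr rfl fun i _ => ?_
    split_ifs
    · simp only [Pi.sub_apply, C_sub, sub_mul]
    · simp
  rw [this]
  refine (polyNorm_sum_le _ _).trans (Finset.sum_le_sum fun i _ => ?_)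
  split_ifs
  · exact (polyNorm_C_mul_X_pow _ _).le
  · rw [polyNorm_zero]; exact norm_nonneg _

/-! ### The exact solutions as polynomials -/

/-- The coefficients `α₁, …, αₙ` of `z ^ (n - κ + 1) p₁`, for `p₁` monic of degree `κ`. -/
def innerSolution (p₁ : ℂ[X]) (κ n : ℕ) (i : Fin n) : ℂ :=
  if n - κ ≤ (i : ℕ) then p₁.coeff (i - (n - κ)) else 0

/-- The first `n - κ` entries of `innerSolution` vanish, so a sum over it runs over the non-leading
coefficients of `p₁`. -/
lemma sum_innerSolution {M : Type*} [AddCommMonoid M] (p₁ : ℂ[X]) {κ n : ℕ} (hκn : κ ≤ n)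
    (F : ℕ → ℂ → M) (hF : ∀ i, F i 0 = 0) :
    ∑ i : Fin n, F i (innerSolution p₁ κ n i) =
      ∑ b ∈ Finset.range κ, F (n - κ + b) (p₁.coeff b) := by
  unfold innerSolution
  rw [Fin.sum_univ_eq_sum_range
    (fun i => F i (if n - κ ≤ i then p₁.coeff (i - (n - κ)) else 0)) n]
  obtain ⟨t, rfl⟩ : ∃ t, n = t + κ := ⟨n - κ, by omega⟩
  rw [Nat.add_sub_cancel, Finset.sum_range_add, Finset.sum_eq_zero, zero_add]
  · simp
  · intro i hi
    rw [if_neg (by simpa using hi), hF]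

lemma eq_sum_add_X_pow {p₁ : ℂ[X]} (hm : p₁.Monic) {κ : ℕ} (hκ : p₁.natDegree = κ) :
    p₁ = ∑ b ∈ Finset.range κ, C (p₁.coeff b) * X ^ b + X ^ κ := by
  subst hκ
  conv_lhs => rw [p₁.as_sum_range_C_mul_X_pow, Finset.sum_range_succ, coeff_natDegree,
    hm.leadingCoeff, C_1, one_mul]

lemma firstPoly_innerSolution {p₁ : ℂ[X]} (hm : p₁.Monic) {κ n : ℕ} (hκ : p₁.natDegree = κ)
    (hn : κ ≤ n) : firstPoly (innerSolution p₁ κ n) = X ^ (n - κ + 1) * p₁ := by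
  conv_rhs => rw [eq_sum_add_X_pow hm hκ]
  rw [firstPoly, sum_innerSolution p₁ hn (fun i a => C a * X ^ (i + 1)) (by simp), mul_add,
    ← pow_add, Finset.mul_sum]
  have h : n - κ + 1 + κ = n + 1 := by omega
  rw [h]
  refine congrArg (· + X ^ (n + 1)) (Finset.sum_congr rfl fun b _ => ?_)
  ring

lemma computedInner_innerSolution {p₁ : ℂ[X]} (hm : p₁.Monic) {κ n : ℕ} (hκ : p₁.natDegree = κ)
    (hn : κ ≤ n) : computedInner κ (innerSolution p₁ κ n) = p₁ := by
  conv_rhs => rw [eq_sum_add_X_pow hm hκ]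
  rw [computedInner, sum_innerSolution p₁ hn (fun i a => if n - κ ≤ i then
    C a * X ^ (i - (n - κ)) else 0) (by simp)]
  simp

lemma secondPoly_coeff {p₂ : ℂ[X]} {n : ℕ} (hn : p₂.natDegree ≤ n) :
    secondPoly (fun i : Fin (n + 1) => p₂.coeff i) = p₂ := by
  conv_rhs => rw [p₂.as_sum_range_C_mul_X_pow' (Nat.lt_succ_of_le hn)]
  exact Fin.sum_univ_eq_sum_range (fun i => C (p₂.coeff i) * X ^ i) (n + 1)

lemma computedOuter_coeff {p₂ : ℂ[X]} {n : ℕ} (hn : p₂.natDegree ≤ n) :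
    computedOuter p₂.natDegree (fun i : Fin (n + 1) => p₂.coeff i) = p₂ := by
  conv_rhs => rw [← secondPoly_coeff hn]
  refine Finset.sum_congr rfl fun i _ => ?_
  split_ifs with h
  · rfl
  · change 0 = C (p₂.coeff i) * X ^ (i : ℕ)
    rw [coeff_eq_zero_of_natDegree_lt (by omega), C_0, zero_mul]

/-! ### The factors of a polynomial without zeros on the unit circle -/

lemma innerFactor_monic (p : ℂ[X]) : (innerFactor p).Monic :=
  monic_multisetProd_X_sub_C _

lemma natDegree_innerFactor (p : ℂ[X]) : (innerFactor p).natDegree = index p :=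
  natDegree_multiset_prod_X_sub_C_eq_card _

lemma innerFactor_mul_outerFactor {p : ℂ[X]} (hp : ∀ z : ℂ, ‖z‖ = 1 → p.eval z ≠ 0) :
    innerFactor p * outerFactor p = p := by
  have hfil : p.roots.filter (fun z => 1 < ‖z‖) = p.roots.filter (fun z => ¬ ‖z‖ < 1) := by
    refine Multiset.filter_congr fun z hz => ?_
    have h1 : ‖z‖ ≠ 1 := fun h => hp z h (isRoot_of_mem_roots hz)
    rw [not_lt]
    exact ⟨le_of_lt, fun h => lt_of_le_of_ne h h1.symm⟩
  conv_rhs => rw [← C_leadingCoeff_mul_prod_multiset_X_sub_C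
    (IsAlgClosed.card_roots_eq_natDegree (p := p)),
    ← Multiset.filter_add_not (fun z : ℂ => ‖z‖ < 1) p.roots, Multiset.map_add, Multiset.prod_add]
  rw [innerFactor, outerFactor, hfil]
  ring

lemma eval_prod_X_sub_C_ne_zero {s : Multiset ℂ} {z : ℂ} (h : z ∉ s) :
    ((s.map fun ξ => X - C ξ).prod).eval z ≠ 0 := by
  rw [eval_multiset_prod, Multiset.map_map]
  refine Multiset.prod_ne_zero fun h0 => ?_
  obtain ⟨ξ, hξ, h1⟩ := Multiset.mem_map.1 h0
  simp only [Function.comp, eval_sub, eval_X, eval_C, sub_eq_zero] at h1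
  exact h (h1 ▸ hξ)

lemma eval_innerFactor_ne_zero (p : ℂ[X]) {z : ℂ} (hz : 1 ≤ ‖z‖) :
    (innerFactor p).eval z ≠ 0 :=
  eval_prod_X_sub_C_ne_zero fun h => absurd (Multiset.mem_filter.1 h).2 (not_lt.2 hz)

lemma eval_outerFactor_ne_zero {p : ℂ[X]} (hp : p ≠ 0) {z : ℂ} (hz : ‖z‖ ≤ 1) :
    (outerFactor p).eval z ≠ 0 := by
  rw [outerFactor, eval_mul, eval_C]
  exact mul_ne_zero (leadingCoeff_ne_zero.2 hp)
    (eval_prod_X_sub_C_ne_zero fun h => absurd (Multiset.mem_filter.1 h).2 (not_lt.2 hz))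

lemma pow_card_le_norm_eval_prod_X_sub_C (s : Multiset ℂ) (hs : ∀ ξ ∈ s, ‖ξ‖ < 1) {z : ℂ}
    (hz : 2 ≤ ‖z‖) : (‖z‖ / 2) ^ s.card ≤ ‖((s.map fun ξ => X - C ξ).prod).eval z‖ := by
  induction s using Multiset.induction with
  | empty => simp
  | cons ξ s ih =>
    rw [Multiset.map_cons, Multiset.prod_cons, Multiset.card_cons, eval_mul, norm_mul, pow_succ,
      mul_comm]
    have h1 : ‖z‖ / 2 ≤ ‖(X - C ξ).eval z‖ := by
      rw [eval_sub, eval_X, eval_C]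
      have := norm_sub_norm_le z ξ
      have := hs ξ (Multiset.mem_cons_self _ _)
      linarith
    exact mul_le_mul h1 (ih fun η hη => hs η (Multiset.mem_cons_of_mem hη)) (by positivity)
      (norm_nonneg _)

lemma norm_inv_eval_innerFactor_mul_le (p : ℂ[X]) {z : ℂ} (hz : 2 ≤ ‖z‖) :
    ‖((innerFactor p).eval z)⁻¹‖ * ‖z‖ ^ index p ≤ 2 ^ index p := by
  have h := pow_card_le_norm_eval_prod_X_sub_C (p.roots.filter fun z => ‖z‖ < 1)
    (fun ξ hξ => (Multiset.mem_filter.1 hξ).2) hz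
  change (‖z‖ / 2) ^ index p ≤ ‖(innerFactor p).eval z‖ at h
  have hpos : 0 < ‖(innerFactor p).eval z‖ :=
    norm_pos_iff.2 (eval_innerFactor_ne_zero p (by linarith))
  rw [norm_inv, inv_mul_le_iff₀ hpos]
  rw [div_pow, div_le_iff₀ (by positivity)] at h
  exact h

/-! ### The unperturbed systems -/

/-- The relations between the Laurent coefficients `c`, `u`, `v` on the unit circle of
`1 / (p₁ p₂)`, `1 / p₁`, `1 / p₂` that drive the argument; the products with `p₁` and `p₂` are
written as convolutions over any range that covers the coefficients. -/
structure IsFactoredInverse (p₁ p₂ : ℂ[X]) (κ : ℕ) (c u v : ℤ → ℂ) : Prop where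
  conv_outer : ∀ N, p₂.natDegree < N → ∀ k,
    ∑ a ∈ Finset.range N, p₂.coeff a * c (k - a) = u k
  conv_inner : ∀ k, ∑ b ∈ Finset.range (κ + 1), p₁.coeff b * c (k - b) = v k
  conv_inner_u : ∀ k, ∑ b ∈ Finset.range (κ + 1), p₁.coeff b * u (k - b) = if k = 0 then 1 else 0
  u_eq_zero : ∀ k, -(κ : ℤ) < k → u k = 0
  v_eq_zero : ∀ k, k < 0 → v k = 0

lemma isFactoredInverse_circleCoeff {p₁ p₂ : ℂ[X]} {κ : ℕ} (hκ : p₁.natDegree = κ)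
    (h1 : ∀ z : ℂ, 1 ≤ ‖z‖ → p₁.eval z ≠ 0) (h2 : ∀ z : ℂ, ‖z‖ ≤ 1 → p₂.eval z ≠ 0) {A : ℝ}
    (hA : ∀ z : ℂ, 2 ≤ ‖z‖ → ‖(p₁.eval z)⁻¹‖ * ‖z‖ ^ κ ≤ A) :
    IsFactoredInverse p₁ p₂ κ (circleCoeff fun z => ((p₁ * p₂).eval z)⁻¹)
      (circleCoeff fun z => (p₁.eval z)⁻¹) (circleCoeff fun z => (p₂.eval z)⁻¹) := by
  have n1 : ∀ z ∈ Metric.sphere (0 : ℂ) 1, p₁.eval z ≠ 0 := fun z hz =>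
    h1 z (mem_sphere_zero_iff_norm.1 hz).ge
  have n2 : ∀ z ∈ Metric.sphere (0 : ℂ) 1, p₂.eval z ≠ 0 := fun z hz =>
    h2 z (mem_sphere_zero_iff_norm.1 hz).le
  have hc : ContinuousOn (fun z => ((p₁ * p₂).eval z)⁻¹) (Metric.sphere (0 : ℂ) 1) :=
    (p₁ * p₂).continuousOn.inv₀ fun z hz => by
      rw [eval_mul]; exact mul_ne_zero (n1 z hz) (n2 z hz)
  refine ⟨fun N hN k => ?_, fun k => ?_, fun k => ?_, fun k hk => ?_, fun k hk => ?_⟩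
  · rw [sum_coeff_mul_circleCoeff hc p₂ hN]
    refine circleCoeff_congr (fun z hz => ?_) k
    have := n1 z hz
    have := n2 z hz
    simp only [eval_mul]
    field_simp
  · rw [sum_coeff_mul_circleCoeff hc p₁ (by omega)]
    refine circleCoeff_congr (fun z hz => ?_) k
    have := n1 z hz
    have := n2 z hz
    simp only [eval_mul]
    field_simp
  · rw [sum_coeff_mul_circleCoeff (g := fun z => (p₁.eval z)⁻¹) (p₁.continuousOn.inv₀ n1) p₁
      (by omega), ← circleCoeff_one]
    refine circleCoeff_congr (fun z hz => ?_) k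
    exact mul_inv_cancel₀ (n1 z hz)
  · exact circleCoeff_eq_zero_of_decay
      (fun z hz => p₁.differentiable.differentiableAt.inv (h1 z hz)) hA hk
  · exact circleCoeff_eq_zero_of_neg
      (fun z hz => p₂.differentiable.differentiableAt.inv (h2 z hz)) hk

variable {p₁ p₂ : ℂ[X]} {κ : ℕ} {c u v : ℤ → ℂ}

/-- No order above `max κ (deg p₂)` is excluded: the two truncations in the inverse compensate each
other even when the order is smaller than the degree of `p₁ p₂`. -/
lemma IsFactoredInverse.exists_right_inverse (h : IsFactoredInverse p₁ p₂ κ c u v)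
    (hκ : p₁.natDegree = κ) {m : ℕ} (hκm : κ < m) (hdm : p₂.natDegree < m) :
    ∃ S, toeplitz c (-(κ : ℤ)) m * S = 1 ∧ ∀ j, ∑ i, ‖S i j‖ ≤ polyNorm p₁ * polyNorm p₂ := by
  obtain ⟨N, rfl⟩ : ∃ N, m = N + 1 := ⟨m - 1, by omega⟩
  refine ⟨toeplitzInverse p₁ p₂ κ p₂.natDegree N, ?_, fun j => ?_⟩
  · exact toeplitz_mul_toeplitzInverse p₁ p₂ (by omega) (by omega) c u v
      (h.conv_outer _ (Nat.lt_succ_self _)) h.conv_inner h.u_eq_zero h.v_eq_zero h.conv_inner_u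
  · rw [polyNorm_eq_sum_range p₁ (N := κ + 1) (by omega),
      polyNorm_eq_sum_range p₂ (Nat.lt_succ_self _)]
    exact sum_norm_toeplitzInverse_le p₁ p₂ κ p₂.natDegree N j

/-- The coefficients of `z ^ (n - κ + 1) p₁` solve the unperturbed first system, because
`z ^ (n - κ + 1) p₁ / (p₁ p₂)` has no Laurent coefficients of negative index. -/
lemma IsFactoredInverse.solvesFirst (h : IsFactoredInverse p₁ p₂ κ c u v)
    (hm : p₁.Monic) (hκ : p₁.natDegree = κ) {n : ℕ} (hn : κ ≤ n) :
    SolvesFirst c κ n (innerSolution p₁ κ n) := by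
  ext i
  have hi := i.2
  simp only [Matrix.mulVec, dotProduct, toeplitz, Matrix.of_apply]
  rw [sum_innerSolution p₁ hn (fun j a => c (-(κ : ℤ) + (i : ℕ) - (j : ℕ)) * a) (by simp)]
  have h1 := h.conv_inner ((i : ℕ) - n)
  have hlead : p₁.coeff κ = 1 := by rw [← hκ]; exact hm
  rw [h.v_eq_zero _ (by omega), Finset.sum_range_succ, hlead, one_mul] at h1
  rw [show -(n : ℤ) - κ + (i : ℕ) = (i : ℕ) - n - κ by ring, ← eq_neg_of_add_eq_zero_left h1]
  refine Finset.sum_congr rfl fun b _ => ?_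
  rw [mul_comm]
  congr 2
  push_cast [hn]
  ring

/-- The coefficients of `p₂` solve the unperturbed second system, because
`p₂ / (p₁ p₂) = z ^ (-κ) + O (z ^ (-κ - 1))` at infinity. -/
lemma IsFactoredInverse.solvesSecond (h : IsFactoredInverse p₁ p₂ κ c u v)
    (hm : p₁.Monic) (hκ : p₁.natDegree = κ) {n : ℕ} (hn : p₂.natDegree ≤ n) :
    SolvesSecond c κ n (fun i => p₂.coeff i) := by
  have hlead : p₁.coeff κ = 1 := by rw [← hκ]; exact hm
  have hu : u (-(κ : ℤ)) = 1 := by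
    have h1 := h.conv_inner_u 0
    rw [Finset.sum_range_succ, Finset.sum_eq_zero, hlead, if_pos rfl, zero_sub] at h1
    · simpa using h1
    · intro b hb
      rw [Finset.mem_range] at hb
      rw [h.u_eq_zero _ (by omega), mul_zero]
  ext i
  simp only [Matrix.mulVec, dotProduct, toeplitz, Matrix.of_apply]
  rw [Fin.sum_univ_eq_sum_range (fun j => c (-(κ : ℤ) + (i : ℕ) - (j : ℕ)) * p₂.coeff j) (n + 1)]
  simp only [mul_comm (c _)]
  rw [h.conv_outer _ (by omega)]
  by_cases hi : i = 0
  · subst hi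
    simpa using hu
  · rw [Pi.single_eq_of_ne hi, h.u_eq_zero]
    have : (i : ℕ) ≠ 0 := fun h' => hi (Fin.ext h')
    omega

/-! ### Error bounds for the computed solutions -/

lemma sum_norm_toeplitz_sub_le {c c' : ℤ → ℂ} {κ m : ℕ} {η : ℝ}
    (hη : ∀ k : ℤ, k.natAbs < m + κ → ‖c' k - c k‖ ≤ η) (j : Fin m) :
    ∑ i, ‖(toeplitz c' (-(κ : ℤ)) m - toeplitz c (-(κ : ℤ)) m) i j‖ ≤ m * η := by
  refine (Finset.sum_le_card_nsmul _ _ η fun i _ => ?_).trans (by simp)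
  have hi := i.2
  have hj := j.2
  simp only [toeplitz, Matrix.sub_apply, Matrix.of_apply]
  exact hη _ (by omega)

lemma sum_pow_sub_le {ρ : ℝ} (hρ0 : 0 ≤ ρ) (hρ1 : ρ < 1) (n κ : ℕ) :
    ∑ i : Fin n, ρ ^ (n + κ - (i : ℕ)) ≤ (1 - ρ)⁻¹ := by
  rw [Fin.sum_univ_eq_sum_range (fun i => ρ ^ (n + κ - i)) n]
  calc ∑ i ∈ Finset.range n, ρ ^ (n + κ - i) ≤ ∑ i ∈ Finset.range n, ρ ^ (n - 1 - i) :=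
        Finset.sum_le_sum fun i _ => pow_le_pow_of_le_one hρ0 hρ1.le (by omega)
    _ = ∑ i ∈ Finset.range n, ρ ^ i := Finset.sum_range_reflect (fun i => ρ ^ i) n
    _ ≤ (1 - ρ)⁻¹ := sum_le_hasSum _ (fun i _ => pow_nonneg hρ0 i)
        (hasSum_geometric_of_lt_one hρ0 hρ1)

/-- Perturbation bound for the first system. The size of the exact solution is controlled through
the system itself and the decay of `c`. -/
lemma IsFactoredInverse.sum_norm_first_sub_le (h : IsFactoredInverse p₁ p₂ κ c u v)
    (hm : p₁.Monic) (hκ : p₁.natDegree = κ) {n : ℕ} (hκn : κ < n) (hdn : p₂.natDegree < n)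
    {c' : ℤ → ℂ} {ρ C D η q : ℝ} (hρ0 : 0 ≤ ρ) (hρ1 : ρ < 1)
    (hcC : ∀ k, ‖c k‖ ≤ C * ρ ^ k.natAbs) (hη0 : 0 ≤ η)
    (hη : ∀ k : ℤ, k.natAbs ≤ n + κ → ‖c' k - c k‖ ≤ η)
    (hD : polyNorm p₁ * polyNorm p₂ ≤ D) (hq : D * (n * η) ≤ q)
    (α : Fin n → ℂ) (hα : SolvesFirst c' κ n α) :
    (1 - q) * ∑ i, ‖(innerSolution p₁ κ n - α) i‖ ≤ D * (n * η * (D * (C * (1 - ρ)⁻¹) + 1)) := by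
  obtain ⟨S, hS, hSD⟩ := h.exists_right_inverse hκ hκn hdn
  have hD0 : 0 ≤ D := (mul_nonneg (polyNorm_nonneg _) (polyNorm_nonneg _)).trans hD
  have hC0 : 0 ≤ C := by simpa using (norm_nonneg _).trans (hcC 0)
  have hex := h.solvesFirst hm hκ hκn.le
  have hT := sum_norm_toeplitz_sub_le (κ := κ) fun k hk => hη k (Nat.le_of_lt hk)
  set a := innerSolution p₁ κ n
  set T := toeplitz c (-(κ : ℤ)) n
  set T' := toeplitz c' (-(κ : ℤ)) n
  -- `a` solves the exact system, whose right-hand side consists of `c` at negative indices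
  have ha : ∑ i, ‖a i‖ ≤ D * (C * (1 - ρ)⁻¹) := by
    have h1 := sum_norm_le_of_perturb T T S (η := 0) (q := 0) hD0 hS (fun j => (hSD j).trans hD)
      (fun j => by simp) (by simp) a
    rw [sub_zero, one_mul] at h1
    refine h1.trans (mul_le_mul_of_nonneg_left ?_ hD0)
    calc ∑ i, ‖T.mulVec a i‖ ≤ ∑ i : Fin n, C * ρ ^ (n + κ - (i : ℕ)) := by
          refine Finset.sum_le_sum fun i _ => ?_
          have hi := i.2
          rw [hex, norm_neg]
          refine (hcC _).trans (le_of_eq ?_)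
          congr 2
          omega
      _ = C * ∑ i : Fin n, ρ ^ (n + κ - (i : ℕ)) := (Finset.mul_sum _ _ _).symm
      _ ≤ C * (1 - ρ)⁻¹ := mul_le_mul_of_nonneg_left (sum_pow_sub_le hρ0 hρ1 n κ) hC0
  refine (sum_norm_le_of_perturb T T' S hD0 hS (fun j => (hSD j).trans hD) hT hq (a - α)).trans
    (mul_le_mul_of_nonneg_left ?_ hD0)
  have hres : ∀ i, ‖T'.mulVec (a - α) i‖ ≤ ‖(T' - T).mulVec a i‖ + η := by
    intro i
    have hi := i.2
    have : T'.mulVec (a - α) i = (T' - T).mulVec a i +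
        (c' (-(n : ℤ) - κ + (i : ℕ)) - c (-(n : ℤ) - κ + (i : ℕ))) := by
      rw [Matrix.mulVec_sub, Matrix.sub_mulVec, hα, hex]
      simp only [Pi.sub_apply]
      ring
    rw [this]
    exact (norm_add_le _ _).trans (add_le_add_right (hη _ (by omega)) _)
  calc ∑ i, ‖T'.mulVec (a - α) i‖ ≤ ∑ i, (‖(T' - T).mulVec a i‖ + η) :=
        Finset.sum_le_sum fun i _ => hres i
    _ = ∑ i, ‖(T' - T).mulVec a i‖ + n * η := by simp [Finset.sum_add_distrib]
    _ ≤ n * η * ∑ i, ‖a i‖ + n * η := add_le_add_left (sum_norm_mulVec_le _ hT a) _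
    _ ≤ n * η * (D * (C * (1 - ρ)⁻¹)) + n * η :=
        add_le_add_left (mul_le_mul_of_nonneg_left ha (by positivity)) _
    _ = _ := by ring

/-- Perturbation bound for the second system. -/
lemma IsFactoredInverse.sum_norm_second_sub_le (h : IsFactoredInverse p₁ p₂ κ c u v)
    (hm : p₁.Monic) (hκ : p₁.natDegree = κ) {n : ℕ} (hκn : κ ≤ n) (hdn : p₂.natDegree ≤ n)
    {c' : ℤ → ℂ} {D η q : ℝ} (hη0 : 0 ≤ η)
    (hη : ∀ k : ℤ, k.natAbs ≤ n + κ → ‖c' k - c k‖ ≤ η)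
    (hD : polyNorm p₁ * polyNorm p₂ ≤ D) (hq : D * ((n + 1 : ℕ) * η) ≤ q)
    (β : Fin (n + 1) → ℂ) (hβ : SolvesSecond c' κ n β) :
    (1 - q) * ∑ i, ‖((fun i : Fin (n + 1) => p₂.coeff i) - β) i‖ ≤
      D * ((n + 1 : ℕ) * η * D) := by
  obtain ⟨S, hS, hSD⟩ := h.exists_right_inverse hκ (Nat.lt_succ_of_le hκn) (Nat.lt_succ_of_le hdn)
  have hD0 : 0 ≤ D := (mul_nonneg (polyNorm_nonneg _) (polyNorm_nonneg _)).trans hD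
  have hex := h.solvesSecond hm hκ hdn
  have hT := sum_norm_toeplitz_sub_le (κ := κ) (m := n + 1) fun k hk => hη k (by omega)
  set b : Fin (n + 1) → ℂ := fun i => p₂.coeff i
  have hb : ∑ i, ‖b i‖ ≤ D := by
    have h1 : (1 : ℝ) ≤ polyNorm p₁ := by
      have := norm_coeff_le_polyNorm p₁ p₁.natDegree
      rwa [coeff_natDegree, hm.leadingCoeff, norm_one] at this
    calc ∑ i, ‖b i‖ = polyNorm p₂ := by
          rw [polyNorm_eq_sum_range p₂ (Nat.lt_succ_of_le hdn)]
          exact Fin.sum_univ_eq_sum_range (fun i => ‖p₂.coeff i‖) (n + 1)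
      _ ≤ polyNorm p₁ * polyNorm p₂ := le_mul_of_one_le_left (polyNorm_nonneg _) h1
      _ ≤ D := hD
  set T := toeplitz c (-(κ : ℤ)) (n + 1)
  set T' := toeplitz c' (-(κ : ℤ)) (n + 1)
  refine (sum_norm_le_of_perturb T T' S hD0 hS (fun j => (hSD j).trans hD) hT hq (b - β)).trans
    (mul_le_mul_of_nonneg_left ?_ hD0)
  have hres : T'.mulVec (b - β) = (T' - T).mulVec b := by
    rw [Matrix.mulVec_sub, Matrix.sub_mulVec, hβ, hex]
  rw [hres]
  exact (sum_norm_mulVec_le _ hT b).trans (mul_le_mul_of_nonneg_left hb (by positivity))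

lemma IsFactoredInverse.isUnit_det_toeplitz (h : IsFactoredInverse p₁ p₂ κ c u v)
    (hκ : p₁.natDegree = κ) {m : ℕ} (hκm : κ < m) (hdm : p₂.natDegree < m)
    {c' : ℤ → ℂ} {D η q : ℝ} (hη : ∀ k : ℤ, k.natAbs < m + κ → ‖c' k - c k‖ ≤ η)
    (hD : polyNorm p₁ * polyNorm p₂ ≤ D) (hq : D * (m * η) ≤ q) (hq1 : q < 1) :
    IsUnit (toeplitz c' (-(κ : ℤ)) m).det := by
  obtain ⟨S, hS, hSD⟩ := h.exists_right_inverse hκ hκm hdm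
  have hD0 : 0 ≤ D := (mul_nonneg (polyNorm_nonneg _) (polyNorm_nonneg _)).trans hD
  exact isUnit_det_of_bounded_below _ (sub_pos.2 hq1) (sum_norm_le_of_perturb _ _ S hD0 hS
    (fun j => (hSD j).trans hD) (sum_norm_toeplitz_sub_le hη) hq)

end WienerHopf

theorem theorem9
    (p : ℂ[X]) (hp0 : p.coeff 0 ≠ 0)
    (r R : ℝ) (hr0 : 0 < r) (hr1 : r < 1) (hR : 1 < R)
    (hK : ∀ z ∈ annulus r R, p.eval z ≠ 0)
    (ν κ : ℕ) (hν : ν = p.natDegree) (hκ : κ = WienerHopf.index p)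
    (hκ0 : 0 < κ) (hκν : κ < ν)
    (ρ mK : ℝ) (hρ : ρ = max r (1 / R)) (hmK : mK = minModulus p r R)
    (p₁ p₂ : ℂ[X]) (hp₁ : p₁ = innerFactor p) (hp₂ : p₂ = outerFactor p)
    (δ₀ : ℝ) (hδ₀ : polyNorm p₁ * polyNorm p₂ ≤ δ₀ * polyNorm p)
    (q : ℝ) (hq0 : 0 < q) (hq1 : q < 1)
    (n : ℕ) (hn : max κ (ν - κ) + 1 ≤ n)
    (l : ℕ) (hl : Even l) (hln : 2 * (n + κ) ≤ l)
    (hsmall : ρ ^ (l / 2) / (1 - ρ ^ l) < q * mK / ((4 * (n : ℝ) + 2) * δ₀ * polyNorm p)) :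
    -- both perturbed systems are uniquely solvable
    IsUnit (toeplitz (approxCoeff p l) (-(κ : ℤ)) n).det ∧
    IsUnit (toeplitz (approxCoeff p l) (-(κ : ℤ)) (n + 1)).det ∧
    (∀ α : Fin n → ℂ, SolvesFirst (approxCoeff p l) κ n α →
      polyNorm (p₁ - computedInner κ α) <
        (4 * (n : ℝ) - 2) * δ₀ * polyNorm p / ((1 - q) * mK) *
          (δ₀ * (1 + ρ) * polyNorm p / ((1 - q) * (1 - ρ) * mK) + 1) *
          (ρ ^ (l / 2) / (1 - ρ ^ l)) ∧
      -- the same bound, with no coefficient discarded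
      polyNorm (X ^ (n - κ + 1) * p₁ - firstPoly α) <
        (4 * (n : ℝ) - 2) * δ₀ * polyNorm p / ((1 - q) * mK) *
          (δ₀ * (1 + ρ) * polyNorm p / ((1 - q) * (1 - ρ) * mK) + 1) *
          (ρ ^ (l / 2) / (1 - ρ ^ l))) ∧
    (∀ β : Fin (n + 1) → ℂ, SolvesSecond (approxCoeff p l) κ n β →
      polyNorm (p₂ - computedOuter (ν - κ) β) <
        (4 * (n : ℝ) + 2) * δ₀ ^ 2 * polyNorm p ^ 2 / ((1 - q) * mK) *
          (ρ ^ (l / 2) / (1 - ρ ^ l)) ∧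
      -- the same bound, with no coefficient discarded
      polyNorm (p₂ - secondPoly β) <
        (4 * (n : ℝ) + 2) * δ₀ ^ 2 * polyNorm p ^ 2 / ((1 - q) * mK) *
          (ρ ^ (l / 2) / (1 - ρ ^ l))) := by
  have hn2 : 2 ≤ n := by omega
  have hκn : κ + 1 ≤ n := by have := le_max_left κ (ν - κ); omega
  have hdn : ν - κ + 1 ≤ n := by have := le_max_right κ (ν - κ); omega
  have hl0 : l ≠ 0 := by omega
  have hρ0 : 0 < ρ := hρ ▸ lt_of_lt_of_le hr0 (le_max_left _ _)
  have hρ1 : ρ < 1 := hρ ▸ max_lt hr1 ((div_lt_one (by linarith)).2 hR)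
  have hpne : p ≠ 0 := by rintro rfl; simp at hp0
  have hcirc : ∀ z : ℂ, ‖z‖ = 1 → p.eval z ≠ 0 := fun z hz =>
    hK z ⟨by linarith, by linarith⟩
  have hfac : p₁ * p₂ = p := by rw [hp₁, hp₂]; exact innerFactor_mul_outerFactor hcirc
  have hm : p₁.Monic := hp₁ ▸ innerFactor_monic p
  have hdeg1 : p₁.natDegree = κ := by rw [hp₁, hκ]; exact natDegree_innerFactor p
  have hp₂0 : p₂ ≠ 0 := by rintro rfl; exact hpne (by rw [← hfac, mul_zero])
  have hdeg2 : p₂.natDegree = ν - κ := by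
    have := natDegree_mul hm.ne_zero hp₂0
    rw [hfac, hdeg1, ← hν] at this
    omega
  have hlau : IsFactoredInverse p₁ p₂ κ (circleCoeff fun z => (p.eval z)⁻¹)
      (circleCoeff fun z => (p₁.eval z)⁻¹) (circleCoeff fun z => (p₂.eval z)⁻¹) := by
    have := isFactoredInverse_circleCoeff (p₂ := p₂) hdeg1
      (fun z hz => hp₁ ▸ eval_innerFactor_ne_zero p hz)
      (fun z hz => hp₂ ▸ eval_outerFactor_ne_zero hpne hz)
      (fun z hz => by rw [hp₁, hκ]; exact norm_inv_eval_innerFactor_mul_le p hz)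
    rwa [hfac] at this
  set c := circleCoeff fun z => (p.eval z)⁻¹ with hc
  have hD0 : 0 < δ₀ * polyNorm p :=
    (mul_pos (polyNorm_pos hm.ne_zero) (polyNorm_pos hp₂0)).trans_le hδ₀
  set D := δ₀ * polyNorm p with hD
  set ε := ρ ^ (l / 2) / (1 - ρ ^ l) with hε
  have hε0 : 0 < ε := div_pos (pow_pos hρ0 _) (sub_pos.2 (pow_lt_one₀ hρ0.le hρ1 hl0))
  have hn0 : (2 : ℝ) ≤ n := by exact_mod_cast hn2
  have hpos : 0 < (4 * (n : ℝ) + 2) * D := by positivity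
  rw [mul_assoc (4 * (n : ℝ) + 2), ← hD, lt_div_iff₀ hpos] at hsmall
  -- positivity of the minimum is forced by the smallness condition, whose left side is positive
  have hmK0 : 0 < mK := pos_of_mul_pos_right ((mul_pos hε0 hpos).trans hsmall) hq0.le
  have hmin : ∀ z : ℂ, r ≤ ‖z‖ → ‖z‖ ≤ R → mK ≤ ‖p.eval z‖ := by
    intro z h1 h2
    rw [hmK]
    refine csInf_le ⟨0, ?_⟩ ⟨z, ⟨h1, h2⟩, rfl⟩
    rintro _ ⟨w, _, rfl⟩
    exact norm_nonneg _
  have hcC : ∀ k, ‖c k‖ ≤ mK⁻¹ * ρ ^ k.natAbs := by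
    refine norm_circleCoeff_le hr0 hr1.le hR.le (hρ ▸ le_max_left _ _)
      (by rw [hρ, ← one_div]; exact le_max_right _ _) (by positivity)
      (fun z h1 h2 => p.differentiable.differentiableAt.inv (hK z ⟨h1, h2⟩)) fun z h1 h2 => ?_
    rw [norm_inv]
    exact inv_anti₀ hmK0 (hmin z h1 h2)
  have hconv : ∀ k, ∑ a ∈ Finset.range (p.natDegree + 1), p.coeff a * c (k - a) =
      if k = 0 then 1 else 0 := by
    intro k
    have hne : ∀ z ∈ Metric.sphere (0 : ℂ) 1, p.eval z ≠ 0 := fun z hz =>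
      hcirc z (mem_sphere_zero_iff_norm.1 hz)
    rw [hc, sum_coeff_mul_circleCoeff (g := fun z => (p.eval z)⁻¹) (p.continuousOn.inv₀ hne) p
      (Nat.lt_succ_self _), ← circleCoeff_one]
    exact circleCoeff_congr (fun z hz => mul_inv_cancel₀ (hne z hz)) k
  have hη : ∀ k : ℤ, k.natAbs ≤ n + κ → ‖approxCoeff p l k - c k‖ ≤ 2 * mK⁻¹ * ε := fun k hk =>
    norm_approxCoeff_sub_le hρ0 hρ1 hcC hconv hl0 (by omega)
  have hη0 : 0 < 2 * mK⁻¹ * ε := by positivity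
  -- the matrix of order `n + 1` only needs `2 n + 2` in place of `4 n + 2`; this slack makes the
  -- final estimates strict
  have hq₂ : D * ((n + 1 : ℕ) * (2 * mK⁻¹ * ε)) ≤ q := by
    have : D * ((n + 1 : ℕ) * (2 * mK⁻¹ * ε)) = ε * ((2 * n + 2) * D) / mK := by
      push_cast
      field_simp
    rw [this, div_le_iff₀ hmK0]
    refine le_trans ?_ hsmall.le
    gcongr
    linarith
  have hq₁ : D * (n * (2 * mK⁻¹ * ε)) ≤ q := by
    refine le_trans ?_ hq₂
    gcongr
    omega
  have hq' : 0 < 1 - q := by linarith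
  have hρ' : 0 < 1 - ρ := by linarith
  refine ⟨?_, ?_, ?_, ?_⟩
  · exact hlau.isUnit_det_toeplitz hdeg1 (by omega) (by omega) (fun k hk => hη k (by omega))
      hδ₀ hq₁ hq1
  · exact hlau.isUnit_det_toeplitz hdeg1 (by omega) (by omega) (fun k hk => hη k (by omega))
      hδ₀ hq₂ hq1
  · intro α hα
    have h1 := hlau.sum_norm_first_sub_le hm hdeg1 (by omega) (by omega) hρ0.le hρ1 hcC hη0.le hη
      hδ₀ hq₁ α hα
    have h2 : ∑ i, ‖(innerSolution p₁ κ n - α) i‖ <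
        (4 * (n : ℝ) - 2) * δ₀ * polyNorm p / ((1 - q) * mK) *
          (δ₀ * (1 + ρ) * polyNorm p / ((1 - q) * (1 - ρ) * mK) + 1) * ε := by
      have hB : D * (mK⁻¹ * (1 - ρ)⁻¹) + 1 ≤
          δ₀ * (1 + ρ) * polyNorm p / ((1 - q) * (1 - ρ) * mK) + 1 := by
        have e : δ₀ * (1 + ρ) * polyNorm p / ((1 - q) * (1 - ρ) * mK) =
            D * (mK⁻¹ * (1 - ρ)⁻¹) * ((1 + ρ) / (1 - q)) := by
          rw [hD]
          field_simp
        rw [e]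
        refine add_le_add_left (le_mul_of_one_le_right (by positivity) ?_) 1
        rw [one_le_div hq']
        linarith
      set B := δ₀ * (1 + ρ) * polyNorm p / ((1 - q) * (1 - ρ) * mK) + 1
      have hB0 : 0 < B := lt_of_lt_of_le (by positivity) hB
      have e : (4 * (n : ℝ) - 2) * δ₀ * polyNorm p / ((1 - q) * mK) * B * ε =
          D * ((2 * n - 1) * (2 * mK⁻¹ * ε) * B) / (1 - q) := by
        rw [hD]
        field_simp
        ring
      rw [e, lt_div_iff₀ hq', mul_comm]
      refine h1.trans_lt ?_
      refine mul_lt_mul_of_pos_left ?_ hD0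
      refine (mul_le_mul_of_nonneg_left hB (by positivity)).trans_lt ?_
      -- `n < 2 n - 1` because `n ≥ 2`
      refine mul_lt_mul_of_pos_right (mul_lt_mul_of_pos_right ?_ hη0) hB0
      linarith
    constructor
    · refine lt_of_le_of_lt ?_ h2
      have := polyNorm_computedInner_sub_le κ (innerSolution p₁ κ n) α
      rwa [computedInner_innerSolution hm hdeg1 (by omega)] at this
    · refine lt_of_le_of_lt ?_ h2
      have := polyNorm_firstPoly_sub_le (innerSolution p₁ κ n) α
      rwa [firstPoly_innerSolution hm hdeg1 (by omega)] at this
  · intro β hβ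
    have h1 := hlau.sum_norm_second_sub_le hm hdeg1 (by omega) (by omega) hη0.le hη hδ₀ hq₂ β hβ
    have h2 : ∑ i, ‖((fun i : Fin (n + 1) => p₂.coeff i) - β) i‖ <
        (4 * (n : ℝ) + 2) * δ₀ ^ 2 * polyNorm p ^ 2 / ((1 - q) * mK) * ε := by
      have e : (4 * (n : ℝ) + 2) * δ₀ ^ 2 * polyNorm p ^ 2 / ((1 - q) * mK) * ε =
          D * ((2 * n + 1) * (2 * mK⁻¹ * ε) * D) / (1 - q) := by
        rw [hD]
        field_simp
        ring
      rw [e, lt_div_iff₀ hq', mul_comm]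
      refine h1.trans_lt (mul_lt_mul_of_pos_left ?_ hD0)
      refine mul_lt_mul_of_pos_right (mul_lt_mul_of_pos_right ?_ hη0) hD0
      push_cast
      linarith
    constructor
    · refine lt_of_le_of_lt ?_ h2
      have := polyNorm_computedOuter_sub_le (ν - κ) (fun i : Fin (n + 1) => p₂.coeff i) β
      rwa [← hdeg2, computedOuter_coeff (by omega), hdeg2] at this
    · refine lt_of_le_of_lt ?_ h2
      have := polyNorm_secondPoly_sub_le (fun i : Fin (n + 1) => p₂.coeff i) β
      rwa [secondPoly_coeff (by omega)] at this
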